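/- Let $\mathcal H$ be a separable complex Hilbert space, finite- or infinite-dimensional, let $\mathcal L(\mathcal H)$ be the bounded operators and $\mathcal T(\mathcal H)$ the trace class operators on it. A (discrete) observable is a finite or countable family $\mathsf A=(\mathsf A_x)_{x\in\Omega_{\mathsf A}}$ of positive bounded operators with $\sum_x\mathsf A_x=\mathbb 1$ (weakly). An instrument implementing $\mathsf A$ is a family $(\mathcal I_x)_{x\in\Omega_{\mathsf A}}$ of completely positive linear maps on $\mathcal T(\mathcal H)$ with $\mathcal I_x^*(\mathbb 1)=\mathsf A_x$ for all $x$, where the adjoint $\Phi^*$ on $\mathcal L(\mathcal H)$ of a map $\Phi$ on $\mathcal T(\mathcal H)$ is given by $\operatorname{tr}(X\,\Phi(Y))=\operatorname{tr}(\Phi^*(X)\,Y)$ for all $X\in\mathcal L(\mathcal H)$, $Y\in\mathcal T(\mathcal H)$. Write $\mathcal I(\varrho)=\sum_x\mathcal I_x(\varrho)$ (trace norm convergence) for the associated channel. Let $\mathsf A$ and $\mathsf B$ be two observables on $\mathcal H$, and suppose that for some $y\in\Omega_{\mathsf B}$ the operator $\mathsf B_y$ is proportional to an orthogonal projection. If $(\mathcal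 I_x)$ is an instrument implementing $\mathsf A$ whose channel $\mathcal I$ satisfies $\mathcal I^*(\mathsf B_y)=\mathsf B_y$, then $[\mathsf A_x,\mathsf B_y]=0$ for all $x\in\Omega_{\mathsf A}$. -/

import Mathlib

open scoped InnerProductSpace ComplexOrder

namespace QMeas

section TraceClass

variable {H : Type*} [NormedAddCommGroup H] [InnerProductSpace ℂ H] [CompleteSpace H]

section Aux

variable {ι κ : Type*}

lemma summable_norm_sq_iff_prod (b : HilbertBasis ι ℂ H) (f : HilbertBasis κ ℂ H)
    (R : H →L[ℂ] H) :
    Summable (fun i => ‖R (b i)‖ ^ 2) ↔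
      Summable (fun p : ι × κ => ‖⟪f p.2, R (b p.1)⟫_ℂ‖ ^ 2) := by
  have key : ∀ x : H, HasSum (fun j => ‖⟪f j, x⟫_ℂ‖ ^ 2) (‖x‖ ^ 2) := by
    intro x
    have h := (f.hasSum_inner_mul_inner x x).mapL Complex.reCLM
    have e1 : ∀ j, Complex.reCLM (⟪x, f j⟫_ℂ * ⟪f j, x⟫_ℂ) = ‖⟪f j, x⟫_ℂ‖ ^ 2 := by
      intro j
      rw [← inner_conj_symm x (f j), ← Complex.normSq_eq_conj_mul_self, Complex.normSq_eq_norm_sq]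
      exact Complex.ofReal_re _
    have e2 : Complex.reCLM ⟪x, x⟫_ℂ = ‖x‖ ^ 2 := by
      rw [inner_self_eq_norm_sq_to_K]; norm_cast
    simpa only [e1, e2] using h
  rw [summable_prod_of_nonneg (fun p => by positivity)]
  simp only [(key _).tsum_eq]
  exact ⟨fun h => ⟨fun i => (key _).summable, h⟩, fun h => h.2⟩

lemma summable_norm_sq_adjoint (b : HilbertBasis ι ℂ H) (f : HilbertBasis κ ℂ H)
    {R : H →L[ℂ] H} (h : Summable (fun i => ‖R (b i)‖ ^ 2)) :
    Summable (fun j => ‖(star R) (f j)‖ ^ 2) := by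
  rw [summable_norm_sq_iff_prod f b]
  rw [summable_norm_sq_iff_prod b f] at h
  refine (h.prod_symm).congr fun p => ?_
  rw [ContinuousLinearMap.star_eq_adjoint, ContinuousLinearMap.adjoint_inner_right,
    norm_inner_symm]
  rfl

lemma summable_norm_sq_comp (b : HilbertBasis ι ℂ H) (f : HilbertBasis κ ℂ H)
    {R : H →L[ℂ] H} (D : H →L[ℂ] H) (h : Summable (fun i => ‖R (b i)‖ ^ 2)) :
    Summable (fun j => ‖R (D (f j))‖ ^ 2) := by
  have h1 := summable_norm_sq_adjoint b b h
  have h2 : Summable (fun i => ‖(star D * star R) (b i)‖ ^ 2) := by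
    refine Summable.of_nonneg_of_le (fun i => by positivity) (fun i => ?_)
      (h1.mul_left (‖star D‖ ^ 2))
    rw [← mul_pow]
    gcongr
    exact (star D).le_opNorm _
  have h3 := summable_norm_sq_adjoint b f h2
  simpa [star_mul] using h3

lemma exists_factor {S T : H →L[ℂ] H} (h : ∀ x, ‖S x‖ ≤ ‖T x‖) :
    ∃ V : H →L[ℂ] H, S = V * T := by
  set K : Submodule ℂ H := (LinearMap.range T.toLinearMap).topologicalClosure with hK
  have hmem : ∀ x, T x ∈ K := fun x => Submodule.le_topologicalClosure _ ⟨x, rfl⟩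
  have : CompleteSpace K := (Submodule.isClosed_topologicalClosure _).completeSpace_coe
  let e : H →ₗ[ℂ] K := T.toLinearMap.codRestrict K hmem
  have hd : DenseRange e := by
    intro y
    rw [Metric.mem_closure_range_iff]
    intro ε hε
    have hy : (y : H) ∈ closure (LinearMap.range T.toLinearMap : Set H) := y.2
    rw [Metric.mem_closure_iff] at hy
    obtain ⟨_, ⟨x, rfl⟩, hx⟩ := hy ε hε
    exact ⟨x, hx⟩
  refine ⟨(S.toLinearMap.extendOfNorm e).comp K.orthogonalProjectionOnto, ?_⟩
  ext x
  have h1 : K.orthogonalProjectionOnto (T x) = e x :=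
    Submodule.orthogonalProjectionOnto_mem_subspace_eq_self (K := K) (e x)
  have h2 := LinearMap.extendOfNorm_eq (f := S.toLinearMap) (e := e) hd
    ⟨1, fun x => by simpa [e] using h x⟩ x
  simp only [mul_apply_eq_comp, ContinuousLinearMap.comp_apply, h1, h2]
  rfl

lemma norm_abs_apply (T : H →L[ℂ] H) (x : H) : ‖(CFC.abs T) x‖ = ‖T x‖ := by
  have hs : star (CFC.abs T) = CFC.abs T := (CFC.abs_nonneg T).isSelfAdjoint.star_eq
  have h : ∀ A : H →L[ℂ] H, ⟪x, (star A * A) x⟫_ℂ = (‖A x‖ : ℂ) ^ 2 := by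
    intro A
    rw [mul_apply_eq_comp, ContinuousLinearMap.star_eq_adjoint,
      ContinuousLinearMap.adjoint_inner_right, inner_self_eq_norm_sq_to_K]
    rfl
  have h1 := h (CFC.abs T)
  rw [hs, CFC.abs_mul_abs, h T] at h1
  have h2 : ‖T x‖ ^ 2 = ‖(CFC.abs T) x‖ ^ 2 := by exact_mod_cast h1
  exact ((sq_eq_sq₀ (norm_nonneg _) (norm_nonneg _)).1 h2).symm

/-- Polar-type decomposition: `T = V |T|` and `|T| = W T` with bounded `V`, `W`. -/
lemma exists_polar (T : H →L[ℂ] H) :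
    ∃ V W : H →L[ℂ] H, T = V * CFC.abs T ∧ CFC.abs T = W * T := by
  obtain ⟨V, hV⟩ := exists_factor (S := T) (T := CFC.abs T) fun x => (norm_abs_apply T x).ge
  obtain ⟨W, hW⟩ := exists_factor (S := CFC.abs T) (T := T) fun x => (norm_abs_apply T x).le
  exact ⟨V, W, hV, hW⟩

lemma exists_sqrt_abs (T : H →L[ℂ] H) :
    ∃ S : H →L[ℂ] H, star S = S ∧ S * S = CFC.abs T :=
  ⟨CFC.sqrt (CFC.abs T), (CFC.sqrt_nonneg _).isSelfAdjoint.star_eq,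
    CFC.sqrt_mul_sqrt_self _ (CFC.abs_nonneg T)⟩

lemma inner_sq_eq {S : H →L[ℂ] H} (hS : star S = S) (x y : H) :
    ⟪x, (S * S) y⟫_ℂ = ⟪S x, S y⟫_ℂ := by
  have h := ContinuousLinearMap.adjoint_inner_left S (S y) x
  rw [← ContinuousLinearMap.star_eq_adjoint, hS] at h
  rw [mul_apply_eq_comp, h]

end Aux

variable (H) in
/-- The index set of a fixed orthonormal (Hilbert) basis of `H`. -/
noncomputable def basisIndex : Set H := (exists_hilbertBasis ℂ H).choose

variable (H) in
/-- A fixed orthonormal (Hilbert) basis of `H`. -/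
noncomputable def onb : HilbertBasis (basisIndex H) ℂ H :=
  (exists_hilbertBasis ℂ H).choose_spec.choose

/-- `T` is trace class: `tr |T| = ∑ i, ⟪e i, |T| (e i)⟫ < ∞`, where `|T| = (T* T)^(1/2)`.
By `isTraceClass_iff` below, the condition does not depend on the orthonormal basis. -/
def IsTraceClass (T : H →L[ℂ] H) : Prop :=
  Summable fun i => (⟪onb H i, (CFC.abs T) (onb H i)⟫_ℂ).re

/-- The trace `tr T = ∑ i, ⟪e i, T (e i)⟫` (meaningful for trace class `T`; by `hasSum_trace`
below, the series then converges in every orthonormal basis, with the same sum). -/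
noncomputable def trace (T : H →L[ℂ] H) : ℂ :=
  ∑' i, ⟪onb H i, T (onb H i)⟫_ℂ

/-- The trace norm `‖T‖₁ = tr |T|` (meaningful for trace class `T`). -/
noncomputable def traceNorm (T : H →L[ℂ] H) : ℝ := (trace (CFC.abs T)).re

section Basic

variable {ι κ : Type*}

lemma summable_abs_iff {T S : H →L[ℂ] H} (hS : star S = S) (hSS : S * S = CFC.abs T)
    (b : HilbertBasis ι ℂ H) :
    Summable (fun i => (⟪b i, (CFC.abs T) (b i)⟫_ℂ).re) ↔ Summable (fun i => ‖S (b i)‖ ^ 2) := by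
  refine summable_congr fun i => ?_
  rw [← hSS, inner_sq_eq hS, inner_self_eq_norm_sq_to_K]
  norm_cast

/-- Trace class does not depend on the orthonormal basis. -/
lemma isTraceClass_iff (T : H →L[ℂ] H) (b : HilbertBasis ι ℂ H) :
    IsTraceClass T ↔ Summable fun i => (⟪b i, (CFC.abs T) (b i)⟫_ℂ).re := by
  obtain ⟨S, hS, hSS⟩ := exists_sqrt_abs T
  unfold IsTraceClass
  rw [summable_abs_iff hS hSS, summable_abs_iff hS hSS]
  exact ⟨fun h => summable_norm_sq_comp _ b 1 h, fun h => summable_norm_sq_comp _ _ 1 h⟩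

lemma IsTraceClass.summable {T : H →L[ℂ] H} (hT : IsTraceClass T) (C D : H →L[ℂ] H)
    (b : HilbertBasis ι ℂ H) : Summable fun i => ⟪C (b i), T (D (b i))⟫_ℂ := by
  obtain ⟨S, hS, hSS⟩ := exists_sqrt_abs T
  obtain ⟨V, W, hV, hW⟩ := exists_polar T
  have h0 : Summable (fun i => ‖S (onb H i)‖ ^ 2) := (summable_abs_iff hS hSS _).1 hT
  have h1 := summable_norm_sq_comp _ b (star V * C) h0
  have h2 := summable_norm_sq_comp _ b D h0
  refine Summable.of_norm_bounded (h1.add h2) fun i => ?_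
  have e : ⟪C (b i), T (D (b i))⟫_ℂ = ⟪S ((star V * C) (b i)), S (D (b i))⟫_ℂ := by
    rw [← inner_sq_eq hS, hSS]
    conv_lhs => rw [hV]
    rw [mul_apply_eq_comp, mul_apply_eq_comp,
      ContinuousLinearMap.star_eq_adjoint, ContinuousLinearMap.adjoint_inner_left]
  rw [e]
  refine (norm_inner_le_norm _ _).trans ?_
  nlinarith [sq_nonneg (‖S ((star V * C) (b i))‖ - ‖S (D (b i))‖),
    sq_nonneg (‖S ((star V * C) (b i))‖ + ‖S (D (b i))‖)]

lemma isTraceClass_of_summable {T : H →L[ℂ] H}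
    (h : ∀ C : H →L[ℂ] H, Summable fun i => ⟪C (onb H i), T (onb H i)⟫_ℂ) : IsTraceClass T := by
  obtain ⟨V, W, hV, hW⟩ := exists_polar T
  have h1 := Complex.reCLM.summable (h (star W))
  refine h1.congr fun i => ?_
  rw [hW, mul_apply_eq_comp, ContinuousLinearMap.star_eq_adjoint,
    ContinuousLinearMap.adjoint_inner_left]
  rfl

/-- Trace class operators form a two-sided ideal; in particular `X Y` is trace class. -/
lemma IsTraceClass.mul_mul {T : H →L[ℂ] H} (hT : IsTraceClass T) (X Y : H →L[ℂ] H) :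
    IsTraceClass (X * T * Y) := by
  refine isTraceClass_of_summable fun C => ?_
  refine (hT.summable (star X * C) Y (onb H)).congr fun i => ?_
  simp only [mul_apply_eq_comp, ContinuousLinearMap.star_eq_adjoint,
    ContinuousLinearMap.adjoint_inner_left]

lemma tsum_inner_eq {T S V : H →L[ℂ] H} (hT : IsTraceClass T) (hS : star S = S)
    (hSS : S * S = CFC.abs T) (hV : T = V * CFC.abs T) {κ : Type*} (b : HilbertBasis κ ℂ H) :
    ∑' i, ⟪b i, T (b i)⟫_ℂ = ∑' j, ⟪S (onb H j), V (S (onb H j))⟫_ℂ := by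
  have h0 : Summable (fun i => ‖S (onb H i)‖ ^ 2) := (summable_abs_iff hS hSS _).1 hT
  have hadj : ∀ x y : H, ⟪S x, y⟫_ℂ = ⟪x, S y⟫_ℂ := fun x y => by
    have h := ContinuousLinearMap.adjoint_inner_left S y x
    rwa [← ContinuousLinearMap.star_eq_adjoint, hS] at h
  have hadjV : ∀ x y : H, ⟪(star V) x, y⟫_ℂ = ⟪x, V y⟫_ℂ := fun x y => by
    rw [ContinuousLinearMap.star_eq_adjoint, ContinuousLinearMap.adjoint_inner_left]
  have e : ∀ x, ⟪x, T x⟫_ℂ = ⟪S ((star V) x), S x⟫_ℂ := fun x => by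
    rw [← inner_sq_eq hS, hSS, hadjV]
    conv_lhs => rw [hV]
    rfl
  generalize onb H = f at h0 ⊢
  have h1 := (summable_norm_sq_iff_prod b f (S * star V)).1
    (summable_norm_sq_comp f b (star V) h0)
  have h2 := (summable_norm_sq_iff_prod b f S).1 (summable_norm_sq_comp f b 1 h0)
  let g : κ → basisIndex H → ℂ := fun i j => ⟪S ((star V) (b i)), f j⟫_ℂ * ⟪f j, S (b i)⟫_ℂ
  have hs : Summable (Function.uncurry g) := by
    refine Summable.of_norm_bounded (h1.add h2) fun p => ?_
    simp only [Function.uncurry, g]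
    rw [norm_mul, norm_inner_symm, mul_apply_eq_comp]
    have : ∀ a b : ℝ, a * b ≤ a ^ 2 + b ^ 2 := fun a b => by
      nlinarith [sq_nonneg (a - b), sq_nonneg (a + b)]
    exact this _ _
  have hrow : ∀ i, ⟪b i, T (b i)⟫_ℂ = ∑' j, g i j := fun i => by
    rw [e, ← f.tsum_inner_mul_inner]
  have hcol : ∀ j, ∑' i, g i j = ⟪S (f j), V (S (f j))⟫_ℂ := fun j => by
    rw [← b.tsum_inner_mul_inner]
    refine tsum_congr fun i => ?_
    simp only [g]
    rw [hadj, hadjV, ← hadj (f j), mul_comm]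
  simp_rw [hrow, ← hcol]
  exact (Summable.tsum_comm (f := g) hs).symm

/-- The trace may be computed in any orthonormal basis. -/
lemma hasSum_trace {T : H →L[ℂ] H} (hT : IsTraceClass T) {κ : Type*}
    (b : HilbertBasis κ ℂ H) : HasSum (fun i => ⟪b i, T (b i)⟫_ℂ) (trace T) := by
  have hs : Summable fun i => ⟪b i, T (b i)⟫_ℂ := by simpa using hT.summable 1 1 b
  obtain ⟨S, hS, hSS⟩ := exists_sqrt_abs T
  obtain ⟨V, W, hV, hW⟩ := exists_polar T
  have h : ∑' i, ⟪b i, T (b i)⟫_ℂ = trace T :=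
    (tsum_inner_eq hT hS hSS hV b).trans (tsum_inner_eq hT hS hSS hV (onb H)).symm
  exact h ▸ hs.hasSum

lemma isTraceClass_rankOne (x y : H) :
    IsTraceClass (InnerProductSpace.rankOne ℂ x y : H →L[ℂ] H) := by
  refine isTraceClass_of_summable fun C => ?_
  refine ((onb H).summable_inner_mul_inner y ((star C) x)).congr fun i => ?_
  simp only [InnerProductSpace.rankOne_apply, inner_smul_right,
    ContinuousLinearMap.star_eq_adjoint, ContinuousLinearMap.adjoint_inner_right]

lemma trace_mul_rankOne (Z : H →L[ℂ] H) (x y : H) :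
    trace (Z * (InnerProductSpace.rankOne ℂ x y : H →L[ℂ] H)) = ⟪y, Z x⟫_ℂ := by
  unfold trace
  rw [← (onb H).tsum_inner_mul_inner]
  refine tsum_congr fun i => ?_
  simp only [mul_apply_eq_comp, InnerProductSpace.rankOne_apply, map_smul, inner_smul_right]

end Basic

variable (H) in
/-- The space of trace class operators on `H`, a linear subspace of the bounded operators. -/
def traceClass : Submodule ℂ (H →L[ℂ] H) where
  carrier := {T | IsTraceClass T}
  zero_mem' := isTraceClass_of_summable fun C => by simp
  add_mem' {S T} hS hT := isTraceClass_of_summable fun C => by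
    simpa [inner_add_right] using (hS.summable C 1 (onb H)).add (hT.summable C 1 (onb H))
  smul_mem' c T hT := isTraceClass_of_summable fun C => by
    simpa [inner_smul_right] using (hT.summable C 1 (onb H)).mul_left c

end TraceClass

section Measurements

variable {H : Type*} [NormedAddCommGroup H] [InnerProductSpace ℂ H] [CompleteSpace H]

/-- A discrete observable (POVM) with outcome set `Ω`: positive operators `A x` with
`∑ x, A x = 1` in the weak operator topology. (For positive operators this is equivalent to
convergence in the strong or the `σ`-weak operator topology.) -/
structure IsObservable {Ω : Type*} (A : Ω → H →L[ℂ] H) : Prop where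
  isPositive : ∀ x, (A x).IsPositive
  hasSum_one : ∀ φ ψ : H, HasSum (fun x => ⟪φ, A x ψ⟫_ℂ) ⟪φ, ψ⟫_ℂ

/-- An `n × n` block matrix of bounded operators on `H` is positive as an operator on
`H ⊕ ⋯ ⊕ H = H ⊗ ℂⁿ`. -/
def BlockPositive {n : ℕ} (M : Matrix (Fin n) (Fin n) (H →L[ℂ] H)) : Prop :=
  ∀ v : Fin n → H, 0 ≤ ∑ i, ∑ j, ⟪v i, M i j (v j)⟫_ℂ

/-- Complete positivity of a linear map `Φ` on the trace class operators: for every `n`, the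
map `Φ ⊗ id` on `n × n` block matrices of trace class operators preserves positivity. -/
def CompletelyPositive (Φ : traceClass H →ₗ[ℂ] traceClass H) : Prop :=
  ∀ (n : ℕ) (Y : Matrix (Fin n) (Fin n) (traceClass H)),
    BlockPositive (Y.map fun T => (T : H →L[ℂ] H)) →
      BlockPositive (Y.map fun T => (Φ T : H →L[ℂ] H))

/-- `Φ*(X) = Z` for the adjoint map `Φ*` on bounded operators, which is defined by the trace
duality `tr (X Φ(Y)) = tr (Φ*(X) Y)` for all trace class `Y`. The operator `Z` is uniquely
determined by this condition, see `AdjointMapsTo.unique`. -/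
def AdjointMapsTo (Φ : traceClass H →ₗ[ℂ] traceClass H) (X Z : H →L[ℂ] H) : Prop :=
  ∀ Y : traceClass H, trace (X * (Φ Y : H →L[ℂ] H)) = trace (Z * (Y : H →L[ℂ] H))

lemma AdjointMapsTo.unique {Φ : traceClass H →ₗ[ℂ] traceClass H} {X Z Z' : H →L[ℂ] H}
    (h : AdjointMapsTo Φ X Z) (h' : AdjointMapsTo Φ X Z') : Z = Z' := by
  ext x
  refine ext_inner_left ℂ fun y => ?_
  have := (h ⟨_, isTraceClass_rankOne x y⟩).symm.trans (h' ⟨_, isTraceClass_rankOne x y⟩)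
  simpa only [trace_mul_rankOne] using this

/-- The instrument `I` (a family of completely positive linear maps on the trace class
operators) implements the observable `A`: `(I x)*(1) = A x` for all outcomes `x`. -/
structure Implements {Ω : Type*} (I : Ω → traceClass H →ₗ[ℂ] traceClass H)
    (A : Ω → H →L[ℂ] H) : Prop where
  completelyPositive : ∀ x, CompletelyPositive (I x)
  adjoint_one : ∀ x, AdjointMapsTo (I x) 1 (A x)

/-- `Φ` is the unconditional state change of `I`, that is `Φ(ϱ) = ∑ x, I x ϱ` for every trace
class operator `ϱ`, the series converging (unconditionally) in trace norm. -/
def IsTotalMap {Ω : Type*} (I : Ω → traceClass H →ₗ[ℂ] traceClass H)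
    (Φ : traceClass H →ₗ[ℂ] traceClass H) : Prop :=
  ∀ Y : traceClass H, Filter.Tendsto
    (fun s : Finset Ω => traceNorm ((Φ Y - ∑ x ∈ s, I x Y : traceClass H) : H →L[ℂ] H))
    Filter.atTop (nhds 0)

end Measurements

end QMeas

/-!
Write `B y = c • P` with `P` a projection; for `c = 0` there is nothing to show, and otherwise the
channel `Φ` of the instrument satisfies `Φ*(P) = P`. Since `A x` is self-adjoint, it commutes with
`P` as soon as `⟨u, A x v⟩ = tr (I x |v⟩⟨u|)` vanishes for all `u` in the range and `v` in the
kernel of `P` (`commute_of_inner_eq_zero`).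

For such `v`, the nonnegative numbers `tr (P I x |v⟩⟨v|)` sum to `tr (P Φ(|v⟩⟨v|)) = ⟨v, P v⟩ = 0`,
so they all vanish; in the same way `tr ((1 - P) I x |u⟩⟨u|) = 0`
(`IsTotalMap.traceMul_eq_zero`). As `I x` is `2`-positive, the block matrix with diagonal
entries `I x |v⟩⟨v|`, `I x |u⟩⟨u|` and off-diagonal entries `I x |v⟩⟨u|`, `I x |u⟩⟨v|` is positive,
and the vanishing on the diagonal propagates to `I x |v⟩⟨u| = (1 - P) (I x |v⟩⟨u|) P`, which has
trace zero (`CompletelyPositive.traceMul_one_eq_zero`).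

Two facts about the trace are needed. Trace norm convergence of the channel has to imply convergence
of `tr (P ·)` (`IsTotalMap.hasSum_of_isStarProjection`): this follows from `|tr T| ≤ ‖T‖₁`, from
`|U T| = |T|` for the unitary `U = 2P - 1`, and from `P = (U + 1) / 2`. And
`tr (P Y) = tr (P Y P)` (`traceMul_eq_trace_compress`): here `U` is used again, since conjugation by
`U` preserves the trace and changes the sign of `P Y (1 - P)`.
-/

open scoped InnerProductSpace ComplexOrder

namespace QMeas

section Blocks

variable {H : Type*} [NormedAddCommGroup H] [InnerProductSpace ℂ H]

/-! ### Positive `2 × 2` block matrices -/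

lemma eq_zero_of_forall_sesquilinear_nonneg {z w c : ℂ}
    (h : ∀ t : ℂ, 0 ≤ starRingEnd ℂ t * z + t * w + c) : z = 0 := by
  have hc := h 0
  have h1 := h 1
  have hI := h Complex.I
  simp only [Complex.le_def] at hc h1 hI
  -- The real parts, along the real and the imaginary axis, are affine functions bounded below.
  have e1 : ∀ r : ℝ, 0 ≤ r * (z + w).re + c.re := fun r => by
    have := (Complex.le_def.1 (h r)).1
    simp at this ⊢
    linarith
  have e2 : ∀ r : ℝ, 0 ≤ r * (z - w).im + c.re := fun r => by
    have := (Complex.le_def.1 (h (r * Complex.I))).1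
    simp at this ⊢
    linarith
  have lin : ∀ a b : ℝ, (∀ r : ℝ, 0 ≤ r * a + b) → a = 0 := fun a b hab => by
    by_contra ha
    have := hab (-(b + 1) / a)
    rw [div_mul_cancel₀ _ ha] at this
    linarith
  have f1 := lin _ _ e1
  have f2 := lin _ _ e2
  -- The imaginary parts vanish; evaluate them at `0`, `1` and `i`.
  simp at hc h1 hI f1 f2
  apply Complex.ext <;> simp <;> linarith [hc.2, h1.2, hI.2]

lemma BlockPositive.diag {n : ℕ} {M : Matrix (Fin n) (Fin n) (H →L[ℂ] H)}
    (hM : BlockPositive M) (i : Fin n) (z : H) : 0 ≤ ⟪z, M i i z⟫_ℂ := by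
  have h := hM (Pi.single i z)
  rw [Finset.sum_eq_single i, Finset.sum_eq_single i] at h
  · simpa using h
  · intro j _ hj
    simp [hj]
  · simp
  · intro j _ hj
    simp [hj]
  · simp

/-- A positive block matrix whose diagonal entry vanishes on `a` has its whole row vanish on `a`.
No symmetry of `M` is assumed: positivity of the complex form forces it. -/
lemma BlockPositive.inner_eq_zero_of_left {M : Matrix (Fin 2) (Fin 2) (H →L[ℂ] H)}
    (hM : BlockPositive M) {a : H} (ha : ⟪a, M 0 0 a⟫_ℂ = 0) (b : H) :
    ⟪a, M 0 1 b⟫_ℂ = 0 := by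
  refine eq_zero_of_forall_sesquilinear_nonneg (w := ⟪b, M 1 0 a⟫_ℂ) (c := ⟪b, M 1 1 b⟫_ℂ)
    fun t => ?_
  have h := hM ![t • a, b]
  simp only [Fin.sum_univ_two, Matrix.cons_val_zero, Matrix.cons_val_one, map_smul,
    inner_smul_left, inner_smul_right, ha, mul_zero, zero_add] at h
  rwa [add_assoc]

lemma BlockPositive.inner_eq_zero_of_right {M : Matrix (Fin 2) (Fin 2) (H →L[ℂ] H)}
    (hM : BlockPositive M) {b : H} (hb : ⟪b, M 1 1 b⟫_ℂ = 0) (a : H) :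
    ⟪a, M 0 1 b⟫_ℂ = 0 := by
  refine eq_zero_of_forall_sesquilinear_nonneg (w := ⟪b, M 1 0 a⟫_ℂ) (c := ⟪a, M 0 0 a⟫_ℂ)
    fun t => ?_
  have h := hM ![a, starRingEnd ℂ t • b]
  simp only [Fin.sum_univ_two, Matrix.cons_val_zero, Matrix.cons_val_one, map_smul,
    inner_smul_left, inner_smul_right, hb, mul_zero, add_zero, Complex.conj_conj] at h
  rwa [add_comm, ← add_assoc]

lemma blockPositive_rankOne {n : ℕ} (w : Fin n → H) :
    BlockPositive
      (Matrix.of fun i j => (InnerProductSpace.rankOne ℂ (w i) (w j) : H →L[ℂ] H)) := by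
  intro v
  have : ∑ i, ∑ j, ⟪v i, (InnerProductSpace.rankOne ℂ (w i) (w j) : H →L[ℂ] H) (v j)⟫_ℂ =
      star (∑ j, ⟪w j, v j⟫_ℂ) * ∑ j, ⟪w j, v j⟫_ℂ := by
    simp only [star_sum, Finset.sum_mul_sum, InnerProductSpace.rankOne_apply, inner_smul_right]
    refine Finset.sum_congr rfl fun i _ => Finset.sum_congr rfl fun j _ => ?_
    rw [mul_comm, ← inner_conj_symm (v i)]
    rfl
  exact this ▸ star_mul_self_nonneg _

end Blocks

variable {H : Type*} [NormedAddCommGroup H] [InnerProductSpace ℂ H] [CompleteSpace H]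

/-! ### The trace is bounded by the trace norm -/

/-- Douglas factorization with a contraction: the norm bound on `V`, which `exists_factor` does not
provide, is what makes `|tr T| ≤ ‖T‖₁` hold with a constant independent of `T`. -/
lemma exists_contraction_factor {S T : H →L[ℂ] H} (h : ∀ x, ‖S x‖ ≤ ‖T x‖) :
    ∃ V : H →L[ℂ] H, ‖V‖ ≤ 1 ∧ S = V * T := by
  set K : Submodule ℂ H := (LinearMap.range T.toLinearMap).topologicalClosure with hK
  have hmem : ∀ x, T x ∈ K := fun x => Submodule.le_topologicalClosure _ ⟨x, rfl⟩
  have : CompleteSpace K := (Submodule.isClosed_topologicalClosure _).completeSpace_coe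
  let e : H →ₗ[ℂ] K := T.toLinearMap.codRestrict K hmem
  have hd : DenseRange e := by
    intro y
    rw [Metric.mem_closure_range_iff]
    intro ε hε
    have hy : (y : H) ∈ closure (LinearMap.range T.toLinearMap : Set H) := y.2
    rw [Metric.mem_closure_iff] at hy
    obtain ⟨_, ⟨x, rfl⟩, hx⟩ := hy ε hε
    exact ⟨x, hx⟩
  have hb : ∀ x, ‖S.toLinearMap x‖ ≤ 1 * ‖e x‖ := fun x => by simpa [e] using h x
  refine ⟨(S.toLinearMap.extendOfNorm e).comp K.orthogonalProjectionOnto, ?_, ?_⟩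
  · refine ContinuousLinearMap.opNorm_le_bound _ zero_le_one fun x => ?_
    exact (LinearMap.norm_extendOfNorm_apply_le hd 1 hb _).trans
      (mul_le_mul_of_nonneg_left (K.norm_orthogonalProjectionOnto_apply_le x) zero_le_one)
  · ext x
    have h1 : K.orthogonalProjectionOnto (T x) = e x :=
      Submodule.orthogonalProjectionOnto_mem_subspace_eq_self (K := K) (e x)
    have h2 := LinearMap.extendOfNorm_eq (f := S.toLinearMap) (e := e) hd ⟨1, hb⟩ x
    simp only [mul_apply_eq_comp, ContinuousLinearMap.comp_apply, h1, h2]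
    rfl

lemma norm_trace_le_traceNorm {T : H →L[ℂ] H} (hT : IsTraceClass T) :
    ‖trace T‖ ≤ traceNorm T := by
  obtain ⟨S, hS, hSS⟩ := exists_sqrt_abs T
  obtain ⟨V, hV1, hV⟩ :=
    exists_contraction_factor (S := T) (T := CFC.abs T) fun x => (norm_abs_apply T x).ge
  have hs : Summable (fun i => ‖S (onb H i)‖ ^ 2) := (summable_abs_iff hS hSS _).1 hT
  have hnorm : traceNorm T = ∑' i, ‖S (onb H i)‖ ^ 2 := by
    have : trace (CFC.abs T) = ((∑' i, ‖S (onb H i)‖ ^ 2 : ℝ) : ℂ) := by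
      rw [Complex.ofReal_tsum]
      refine tsum_congr fun i => ?_
      rw [← hSS, inner_sq_eq hS, inner_self_eq_norm_sq_to_K]
      norm_cast
    rw [traceNorm, this, Complex.ofReal_re]
  rw [hnorm, trace, tsum_inner_eq hT hS hSS hV (onb H)]
  refine tsum_of_norm_bounded hs.hasSum fun i => ?_
  calc ‖⟪S (onb H i), V (S (onb H i))⟫_ℂ‖ ≤ ‖S (onb H i)‖ * ‖V (S (onb H i))‖ :=
        norm_inner_le_norm _ _
    _ ≤ ‖S (onb H i)‖ * ‖S (onb H i)‖ := by
        gcongr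
        simpa using V.le_of_opNorm_le hV1 (S (onb H i))
    _ = _ := (sq _).symm

/-! ### The trace functional `Y ↦ tr (X Y)` -/

lemma IsTraceClass.mul_left {T : H →L[ℂ] H} (hT : IsTraceClass T) (X : H →L[ℂ] H) :
    IsTraceClass (X * T) := by simpa using hT.mul_mul X 1

lemma trace_add {S T : H →L[ℂ] H} (hS : IsTraceClass S) (hT : IsTraceClass T) :
    trace (S + T) = trace S + trace T := by
  rw [trace, ← ((hasSum_trace hS (onb H)).add (hasSum_trace hT (onb H))).tsum_eq]
  simp

lemma trace_smul (c : ℂ) (T : H →L[ℂ] H) : trace (c • T) = c * trace T := by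
  rw [trace, trace, ← tsum_mul_left]
  simp

/-- The linear functional `Y ↦ tr (X Y)` on the trace class operators. -/
noncomputable def traceMul (X : H →L[ℂ] H) : traceClass H →ₗ[ℂ] ℂ where
  toFun Y := trace (X * (Y : H →L[ℂ] H))
  map_add' S T := by
    rw [Submodule.coe_add, mul_add]
    exact trace_add (S.2.mul_left X) (T.2.mul_left X)
  map_smul' c T := by
    rw [Submodule.coe_smul, mul_smul_comm, trace_smul]
    rfl

lemma traceMul_apply (X : H →L[ℂ] H) (Y : traceClass H) :
    traceMul X Y = trace (X * (Y : H →L[ℂ] H)) := rfl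

lemma traceMul_add (X Z : H →L[ℂ] H) (Y : traceClass H) :
    traceMul (X + Z) Y = traceMul X Y + traceMul Z Y := by
  simp only [traceMul_apply, add_mul]
  exact trace_add (Y.2.mul_left X) (Y.2.mul_left Z)

lemma traceMul_smul (c : ℂ) (X : H →L[ℂ] H) (Y : traceClass H) :
    traceMul (c • X) Y = c * traceMul X Y := by
  simp only [traceMul_apply, smul_mul_assoc, trace_smul]

/-- The isometry `U` leaves the modulus of `T` unchanged, so `|tr (U T)| ≤ ‖U T‖₁ = ‖T‖₁`. -/
lemma norm_traceMul_le_of_isometry {U : H →L[ℂ] H} (hU : star U * U = 1) (Y : traceClass H) :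
    ‖traceMul U Y‖ ≤ traceNorm (Y : H →L[ℂ] H) := by
  have habs : CFC.abs (U * (Y : H →L[ℂ] H)) = CFC.abs (Y : H →L[ℂ] H) := by
    rw [CFC.abs, CFC.abs, star_mul, mul_assoc, ← mul_assoc (star U), hU, one_mul]
  have h := norm_trace_le_traceNorm (IsTraceClass.mul_left Y.2 U)
  rwa [traceNorm, habs] at h

lemma IsTotalMap.hasSum_of_isometry {Ω : Type*} {I : Ω → traceClass H →ₗ[ℂ] traceClass H}
    {Φ : traceClass H →ₗ[ℂ] traceClass H} (h : IsTotalMap I Φ) {U : H →L[ℂ] H}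
    (hU : star U * U = 1) (Y : traceClass H) :
    HasSum (fun x => traceMul U (I x Y)) (traceMul U (Φ Y)) := by
  rw [HasSum, SummationFilter.unconditional_filter, tendsto_iff_norm_sub_tendsto_zero]
  refine squeeze_zero (fun _ => norm_nonneg _) (fun s => ?_) (h Y)
  rw [norm_sub_rev, ← map_sum, ← map_sub]
  exact norm_traceMul_le_of_isometry hU _

/-- For a projection `P` the functional `tr (P ·)` is continuous for the trace norm, because
`2P - 1` is unitary. -/
lemma IsTotalMap.hasSum_of_isStarProjection {Ω : Type*}
    {I : Ω → traceClass H →ₗ[ℂ] traceClass H}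
    {Φ : traceClass H →ₗ[ℂ] traceClass H} (h : IsTotalMap I Φ) {P : H →L[ℂ] H}
    (hP : IsStarProjection P) (Y : traceClass H) :
    HasSum (fun x => traceMul P (I x Y)) (traceMul P (Φ Y)) := by
  have hU : star (2 * P - 1) * (2 * P - 1) = 1 :=
    (Unitary.mem_iff.1 hP.two_mul_sub_one_mem_unitary).1
  have key : ∀ Z : traceClass H,
      traceMul P Z = 2⁻¹ * (traceMul (2 * P - 1) Z + traceMul 1 Z) := fun Z => by
    rw [← traceMul_add, ← traceMul_smul, sub_add_cancel, two_mul, ← two_smul ℂ P, smul_smul]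
    norm_num
  simp only [key]
  exact ((h.hasSum_of_isometry hU Y).add (h.hasSum_of_isometry (by simp) Y)).mul_left _

/-! ### Compressions by projections -/

lemma trace_star_mul_mul_unitary {T U : H →L[ℂ] H} (hT : IsTraceClass T)
    (hU : U ∈ unitary (H →L[ℂ] H)) : trace (star U * T * U) = trace T := by
  let e : H ≃ₗᵢ[ℂ] H := Unitary.linearIsometryEquiv ⟨U, hU⟩
  let b : HilbertBasis (basisIndex H) ℂ H := .ofRepr (e.symm.trans (onb H).repr)
  have hb : ∀ i, b i = U (onb H i) := fun i => rfl
  rw [← (hasSum_trace hT b).tsum_eq, trace]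
  refine tsum_congr fun i => ?_
  rw [hb, mul_apply_eq_comp, mul_apply_eq_comp, ContinuousLinearMap.star_eq_adjoint,
    ContinuousLinearMap.adjoint_inner_right]

/-- An operator that maps into the range of `P` and vanishes on it, so that only one off-diagonal
block is nonzero, has trace zero: conjugation by the reflection `2P - 1` turns it into its negative. -/
lemma trace_eq_zero_of_offDiagonal {T P : H →L[ℂ] H} (hT : IsTraceClass T)
    (hP : IsStarProjection P) (h1 : P * T = T) (h2 : T * P = 0) : trace T = 0 := by
  have h := trace_star_mul_mul_unitary hT hP.two_mul_sub_one_mem_unitary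
  have hs : star (2 * P - 1) = 2 * P - 1 := by
    simp [hP.isSelfAdjoint.star_eq, two_mul]
  have e : (2 * P - 1) * T * (2 * P - 1) = (-1 : ℂ) • T := by
    have : (2 * P - 1) * T = T := by
      rw [sub_mul, mul_assoc, h1, one_mul, two_mul, add_sub_cancel_right]
    rw [this, mul_sub, two_mul, mul_add, h2]
    simp
  rw [hs, e, trace_smul] at h
  have : trace T = -trace T := by simpa using h.symm
  exact self_eq_neg.1 this

lemma traceMul_eq_trace_compress {P : H →L[ℂ] H} (hP : IsStarProjection P) (Y : traceClass H) :
    traceMul P Y = trace (P * (Y : H →L[ℂ] H) * P) := by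
  have hPP : P * P = P := hP.isIdempotentElem
  have h0 : trace (P * (Y : H →L[ℂ] H) * (1 - P)) = 0 := by
    refine trace_eq_zero_of_offDiagonal (IsTraceClass.mul_mul Y.2 _ _) hP ?_ ?_
    · rw [← mul_assoc, ← mul_assoc, hPP]
    · rw [mul_assoc, hP.one_sub_mul_self, mul_zero]
  have h := trace_add (IsTraceClass.mul_mul Y.2 P P) (IsTraceClass.mul_mul Y.2 P (1 - P))
  rw [← mul_add, add_sub_cancel, mul_one, h0, add_zero] at h
  exact h

/-- In contrast to the series defining `tr (P Y)`, this one has nonnegative terms if `Y ≥ 0`. -/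
lemma hasSum_traceMul {P : H →L[ℂ] H} (hP : IsStarProjection P) (Y : traceClass H) :
    HasSum (fun i => ⟪P (onb H i), (Y : H →L[ℂ] H) (P (onb H i))⟫_ℂ) (traceMul P Y) := by
  rw [traceMul_eq_trace_compress hP]
  convert hasSum_trace (IsTraceClass.mul_mul Y.2 P P) (onb H) using 2 with i
  conv_rhs => rw [mul_apply_eq_comp, mul_apply_eq_comp, ← hP.isSelfAdjoint.star_eq,
    ContinuousLinearMap.star_eq_adjoint, ContinuousLinearMap.adjoint_inner_right,
    ← ContinuousLinearMap.star_eq_adjoint, hP.isSelfAdjoint.star_eq]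

lemma eq_zero_of_inner_onb {W : H →L[ℂ] H} (h : ∀ i z, ⟪onb H i, W z⟫_ℂ = 0) : W = 0 := by
  ext z
  refine (onb H).repr.injective ?_
  ext i
  simpa [HilbertBasis.repr_apply_apply] using h i z

lemma inner_eq_zero_of_traceMul_eq_zero {P : H →L[ℂ] H} (hP : IsStarProjection P)
    {Y : traceClass H} (hY : ∀ z, 0 ≤ ⟪z, (Y : H →L[ℂ] H) z⟫_ℂ) (h : traceMul P Y = 0)
    (i : basisIndex H) : ⟪P (onb H i), (Y : H →L[ℂ] H) (P (onb H i))⟫_ℂ = 0 := by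
  have h0 := hasSum_traceMul hP Y
  rw [h] at h0
  exact congrFun ((hasSum_zero_iff_of_nonneg fun _ => hY _).1 h0) i

lemma traceMul_nonneg {P : H →L[ℂ] H} (hP : IsStarProjection P)
    {Y : traceClass H} (hY : ∀ z, 0 ≤ ⟪z, (Y : H →L[ℂ] H) z⟫_ℂ) : 0 ≤ traceMul P Y :=
  (hasSum_traceMul hP Y).nonneg fun _ => hY _

/-! ### Completely positive maps on rank one operators -/

/-- `|x⟩⟨y|` as a trace class operator. -/
noncomputable def ketBra (x y : H) : traceClass H :=
  ⟨InnerProductSpace.rankOne ℂ x y, isTraceClass_rankOne x y⟩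

lemma traceMul_ketBra (X : H →L[ℂ] H) (x y : H) : traceMul X (ketBra x y) = ⟪y, X x⟫_ℂ :=
  trace_mul_rankOne X x y

lemma CompletelyPositive.blockPositive_ketBra {Ψ : traceClass H →ₗ[ℂ] traceClass H}
    (hΨ : CompletelyPositive Ψ) {n : ℕ} (w : Fin n → H) :
    BlockPositive (Matrix.of fun i j => (Ψ (ketBra (w i) (w j)) : H →L[ℂ] H)) :=
  hΨ n (Matrix.of fun i j => ketBra (w i) (w j)) (blockPositive_rankOne w)

/-- If the total map sends `|v⟩⟨v|` to an operator supported on the kernel of `P`, then so does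
each operation of the instrument, since `tr (P Φ(|v⟩⟨v|))` is a sum of nonnegative terms. -/
lemma IsTotalMap.traceMul_eq_zero {Ω : Type*} {I : Ω → traceClass H →ₗ[ℂ] traceClass H}
    {Φ : traceClass H →ₗ[ℂ] traceClass H} (h : IsTotalMap I Φ)
    (hI : ∀ x, CompletelyPositive (I x)) {P : H →L[ℂ] H} (hP : IsStarProjection P) {v : H}
    (hv : traceMul P (Φ (ketBra v v)) = 0) (x : Ω) : traceMul P (I x (ketBra v v)) = 0 := by
  have hnn : ∀ x, 0 ≤ traceMul P (I x (ketBra v v)) := fun x =>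
    traceMul_nonneg hP ((hI x).blockPositive_ketBra ![v] |>.diag 0)
  exact congrFun ((hasSum_zero_iff_of_nonneg hnn).1
    (hv ▸ h.hasSum_of_isStarProjection hP (ketBra v v))) x

/-- If `Ψ` maps `|v⟩⟨v|` and `|u⟩⟨u|` to operators supported on the kernel and on the range of a
projection `P`, respectively, then by `2`-positivity it maps `|v⟩⟨u|` to an operator from the range to the kernel, of trace zero. -/
lemma CompletelyPositive.traceMul_one_eq_zero {Ψ : traceClass H →ₗ[ℂ] traceClass H}
    (hΨ : CompletelyPositive Ψ) {P : H →L[ℂ] H} (hP : IsStarProjection P) {u v : H}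
    (hv : traceMul P (Ψ (ketBra v v)) = 0) (hu : traceMul (1 - P) (Ψ (ketBra u u)) = 0) :
    traceMul 1 (Ψ (ketBra v u)) = 0 := by
  have hM := hΨ.blockPositive_ketBra ![v, u]
  let Z : H →L[ℂ] H := Ψ (ketBra v u)
  have h1 : P * Z = 0 := eq_zero_of_inner_onb fun i z => by
    have := hM.inner_eq_zero_of_left
      (inner_eq_zero_of_traceMul_eq_zero hP (hM.diag 0) hv i) z
    rw [mul_apply_eq_comp, ← hP.isSelfAdjoint.star_eq, ContinuousLinearMap.star_eq_adjoint,
      ContinuousLinearMap.adjoint_inner_right]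
    exact this
  have h2 : Z * (1 - P) = 0 := by
    rw [← star_eq_zero]
    refine eq_zero_of_inner_onb fun i z => ?_
    have := hM.inner_eq_zero_of_right
      (inner_eq_zero_of_traceMul_eq_zero hP.one_sub (hM.diag 1) hu i) z
    rw [ContinuousLinearMap.star_eq_adjoint, ContinuousLinearMap.adjoint_inner_right,
      ← inner_conj_symm, mul_apply_eq_comp]
    exact (congrArg _ this).trans (map_zero _)
  rw [traceMul_apply, one_mul]
  exact trace_eq_zero_of_offDiagonal (Ψ (ketBra v u)).2 hP.one_sub
    (by rw [sub_mul, one_mul]; exact sub_eq_self.2 h1) h2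

/-! ### Commutation with a fixed projection -/

/-- An instrument whose total map fixes the projection `P` satisfies `⟨u, A x v⟩ = 0` for `u` in
the range and `v` in the kernel of `P`. -/
lemma Implements.inner_eq_zero {Ω : Type*} {A : Ω → H →L[ℂ] H} (hA : IsObservable A)
    {I : Ω → traceClass H →ₗ[ℂ] traceClass H} (hI : Implements I A)
    {Φ : traceClass H →ₗ[ℂ] traceClass H} (hΦ : IsTotalMap I Φ) {P : H →L[ℂ] H}
    (hP : IsStarProjection P) (hfix : AdjointMapsTo Φ P P) {u v : H} (hu : P u = u)
    (hv : P v = 0) (x : Ω) : ⟪u, A x v⟫_ℂ = 0 := by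
  have hone : ∀ (x : Ω) (Y : traceClass H), traceMul 1 (I x Y) = traceMul (A x) Y :=
    hI.adjoint_one
  have hP' : ∀ Y : traceClass H, traceMul P (Φ Y) = traceMul P Y := hfix
  have htot : traceMul 1 (Φ (ketBra u u)) = ⟪u, u⟫_ℂ := by
    refine (hΦ.hasSum_of_isometry (by simp) _).unique ?_
    simpa only [hone, traceMul_ketBra] using hA.hasSum_one u u
  rw [← traceMul_ketBra, ← hone]
  refine (hI.completelyPositive x).traceMul_one_eq_zero hP ?_ ?_
  · refine hΦ.traceMul_eq_zero hI.completelyPositive hP ?_ x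
    rw [hP', traceMul_ketBra, hv, inner_zero_right]
  · refine hΦ.traceMul_eq_zero hI.completelyPositive hP.one_sub ?_ x
    have h := traceMul_add P (1 - P) (Φ (ketBra u u))
    rw [add_sub_cancel, htot, hP', traceMul_ketBra, hu] at h
    exact left_eq_add.1 h

lemma commute_of_inner_eq_zero {T P : H →L[ℂ] H} (hT : IsSelfAdjoint T)
    (hP : IsStarProjection P) (h : ∀ u v, P u = u → P v = 0 → ⟪u, T v⟫_ℂ = 0) :
    Commute T P := by
  have hPP : P * P = P := hP.isIdempotentElem
  have h0 : P * (T * (1 - P)) = 0 := by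
    ext z
    refine ext_inner_left ℂ fun w => ?_
    rw [mul_apply_eq_comp, ← hP.isSelfAdjoint.star_eq, ContinuousLinearMap.star_eq_adjoint,
      ContinuousLinearMap.adjoint_inner_right, ← ContinuousLinearMap.star_eq_adjoint,
      hP.isSelfAdjoint.star_eq, mul_apply_eq_comp]
    refine (h _ _ ?_ ?_).trans (inner_zero_right w).symm
    · rw [← mul_apply_eq_comp, hPP]
    · rw [← mul_apply_eq_comp, hP.mul_one_sub_self]
      rfl
  have h1 : P * T = P * T * P := by
    rwa [mul_sub, mul_one, mul_sub, sub_eq_zero, ← mul_assoc] at h0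
  have h2 := congrArg star h1
  simp only [star_mul, hT.star_eq, hP.isSelfAdjoint.star_eq] at h2
  rw [Commute, SemiconjBy, h1, h2, mul_assoc]

end QMeas

theorem proposition2p2 {H : Type*} [NormedAddCommGroup H] [InnerProductSpace ℂ H]
    [CompleteSpace H] [TopologicalSpace.SeparableSpace H]
    {ΩA ΩB : Type*} [Countable ΩA] [Countable ΩB]
    (A : ΩA → H →L[ℂ] H) (hA : QMeas.IsObservable A)
    (B : ΩB → H →L[ℂ] H) (hB : QMeas.IsObservable B)
    (y : ΩB) (hBy : ∃ (c : ℂ) (P : H →L[ℂ] H), IsStarProjection P ∧ B y = c • P)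
    (I : ΩA → QMeas.traceClass H →ₗ[ℂ] QMeas.traceClass H) (hI : QMeas.Implements I A)
    (Itot : QMeas.traceClass H →ₗ[ℂ] QMeas.traceClass H) (hItot : QMeas.IsTotalMap I Itot)
    (hfix : QMeas.AdjointMapsTo Itot (B y) (B y)) :
    ∀ x : ΩA, ⁅A x, B y⁆ = 0 := by
  intro x
  obtain ⟨c, P, hP, hc⟩ := hBy
  rw [← commute_iff_lie_eq, hc]
  rcases eq_or_ne c 0 with rfl | hc0
  · rw [zero_smul]
    exact Commute.zero_right _
  have hfixP : QMeas.AdjointMapsTo Itot P P := fun Y => by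
    have h := hfix Y
    rw [hc, smul_mul_assoc, smul_mul_assoc, QMeas.trace_smul, QMeas.trace_smul] at h
    exact mul_left_cancel₀ hc0 h
  exact (QMeas.commute_of_inner_eq_zero (hA.isPositive x).isSelfAdjoint hP
    fun u v hu hv => hI.inner_eq_zero hA hItot hP hfixP hu hv x).smul_right c
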